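/- Let $A$ be a $C^*$-algebra (not necessarily unital), faithfully and non-degenerately represented on a Hilbert space $H$, with multiplier algebra $M(A)$ (acting on $H$ by the canonical extension of the representation) and algebra of left multipliers $LM(A)$, that is, bounded operators $u:A\to A$ with $u(ab)=u(a)b$; $M(A)\subseteq LM(A)$. A sequence $u_n\in LM(A)$ converges left strictly to $u\in LM(A)$ if $\|u_n a-u a\|\to 0$ for every $a\in A$. Let $\ell_2(A)$ be the standard (right) Hilbert $A$-module of sequences $x=(x_i)$ in $A$ with $\sum_i x_i^*x_i$ norm-convergent and $\langle x,y\rangle=\sum_i x_i^*y_i$. Let $M(\ell_2(A))$ be its multiplier module: the adjointable maps $\beta:A\to\ell_2(A)$, with the right $M(A)$-action $(\beta m)(a)=\beta(ma)$, the $M(A)$-valued inner product $\langle\beta,\gamma\rangle=\beta^*\gamma$ and the norm $\|\beta\|=\|\langle\beta,\beta\rangle\|^{1/2}$; the coordinates $\beta_i\in M(A)$ of $\beta$ are given by $\beta_i a=(\beta(a))_i$. Let $(M(\ell_2(A)))'$ be the dual module of all bounded $M(A)$-linear maps $F:M(\ell_2(A))\to M(A)$, with the right $M(A)$-action $(Fm)(\beta)=m^*F(\beta)$.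 For a sequence $\alpha=(\alpha_i)$ in $M(A)$, the partial sums of $\sum_i\alpha_i^*\alpha_i$ are bounded in norm if and only if this series converges strongly in $B(H)$. The sequences $\alpha$ such that 1) the partial sums of $\sum_i\alpha_i^*\alpha_i$ are bounded (equivalently, the series converges strongly in $B(H)$); 2) the series $\sum_i\alpha_i^*\beta_i$ converges left strictly in $LM(A)$ for every $\beta\in M(\ell_2(A))$; 3) for every $\beta\in M(\ell_2(A))$ the limit in 2) belongs to $M(A)\subseteq LM(A)$; form a right $M(A)$-module under entrywise addition and $(\alpha m)_i=\alpha_i m$, and the dual module $(M(\ell_2(A)))'$ is isomorphic to it as a right $M(A)$-module, by an isomorphism under which the functional $F$ corresponding to $\alpha$ is $$F(\beta)=\sum_i\alpha_i^*\beta_i\qquad(\beta\in M(\ell_2(A))),$$ the series converging left strictly. -/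

import Mathlib

open Filter Topology
open scoped MultiplierAlgebra WithCStarModule

namespace MultiplierDual

noncomputable section

/-! ### The standard module `ℓ₂(A)` -/

section CauchySchwarz

variable {B : Type*} [NonUnitalCStarAlgebra B]

theorem norm_sum_star_mul_sq_le {ι : Type*} (s : Finset ι) (x y : ι → B) :
    ‖∑ i ∈ s, star (x i) * y i‖ ^ 2 ≤
      ‖∑ i ∈ s, star (x i) * x i‖ * ‖∑ i ∈ s, star (y i) * y i‖ := by
  let _ : PartialOrder B := CStarAlgebra.spectralOrder B
  have : StarOrderedRing B := CStarAlgebra.spectralOrderedRing B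
  let X : C⋆ᵐᵒᵈ(B, s → B) := (WithCStarModule.equiv B (s → B)).symm fun i => star (x i)
  let Y : C⋆ᵐᵒᵈ(B, s → B) := (WithCStarModule.equiv B (s → B)).symm fun i => star (y i)
  have h : ‖inner B Y X‖ ≤ ‖Y‖ * ‖X‖ := CStarModule.norm_inner_le (A := B) C⋆ᵐᵒᵈ(B, s → B)
  have h1 : inner B Y X = ∑ i ∈ s, star (x i) * y i := by
    rw [WithCStarModule.pi_inner, ← Finset.sum_coe_sort s]
    refine Finset.sum_congr rfl fun i _ => ?_
    rw [WithCStarModule.inner_def]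
    simp [X, Y]
  have h2 : ‖X‖ ^ 2 = ‖∑ i ∈ s, star (x i) * x i‖ := by
    rw [WithCStarModule.pi_norm_sq, ← Finset.sum_coe_sort s]
    congr 1
    refine Finset.sum_congr rfl fun i _ => ?_
    rw [WithCStarModule.inner_def]
    simp [X]
  have h3 : ‖Y‖ ^ 2 = ‖∑ i ∈ s, star (y i) * y i‖ := by
    rw [WithCStarModule.pi_norm_sq, ← Finset.sum_coe_sort s]
    congr 1
    refine Finset.sum_congr rfl fun i _ => ?_
    rw [WithCStarModule.inner_def]
    simp [Y]
  rw [← h1, ← h2, ← h3, ← mul_pow, mul_comm ‖X‖]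
  exact pow_le_pow_left₀ (norm_nonneg _) h 2

theorem norm_sum_star_add_le {ι : Type*} (s : Finset ι) (x y : ι → B) :
    ‖∑ i ∈ s, star (x i + y i) * (x i + y i)‖ ≤
      2 * (‖∑ i ∈ s, star (x i) * x i‖ + ‖∑ i ∈ s, star (y i) * y i‖) := by
  have e : ∑ i ∈ s, star (x i + y i) * (x i + y i) =
      (∑ i ∈ s, star (x i) * x i + ∑ i ∈ s, star (y i) * y i) +
      (∑ i ∈ s, star (x i) * y i + ∑ i ∈ s, star (y i) * x i) := by
    simp only [← Finset.sum_add_distrib]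
    refine Finset.sum_congr rfl fun i _ => ?_
    simp only [star_add, add_mul, mul_add]
    abel
  have h1 := norm_sum_star_mul_sq_le s x y
  have h2 := norm_sum_star_mul_sq_le s y x
  set a := ‖∑ i ∈ s, star (x i) * x i‖
  set b := ‖∑ i ∈ s, star (y i) * y i‖
  have ha : 0 ≤ a := norm_nonneg _
  have hb : 0 ≤ b := norm_nonneg _
  have key : ∀ t : ℝ, t ^ 2 ≤ a * b → t ≤ (a + b) / 2 := fun t ht => by
    nlinarith [sq_nonneg (a - b), abs_le_of_sq_le_sq' (a := t) (b := (a + b) / 2)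
      (by nlinarith [sq_nonneg (a - b)]) (by positivity)]
  have k1 := key _ h1
  have k2 := key _ (by rw [mul_comm a b]; exact h2)
  rw [e]
  refine (norm_add_le _ _).trans ?_
  refine (add_le_add (norm_add_le _ _) (norm_add_le _ _)).trans ?_
  linarith

theorem summable_star_mul {x y : ℕ → B} (hx : Summable fun i => star (x i) * x i)
    (hy : Summable fun i => star (y i) * y i) : Summable fun i => star (x i) * y i := by
  rw [summable_iff_vanishing_norm] at hx hy ⊢
  intro ε hε
  obtain ⟨s, hs⟩ := hx ε hε
  obtain ⟨t, ht⟩ := hy ε hε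
  classical
  refine ⟨s ∪ t, fun u hu => ?_⟩
  have h1 := hs u (hu.mono_right Finset.subset_union_left)
  have h2 := ht u (hu.mono_right Finset.subset_union_right)
  have h3 := norm_sum_star_mul_sq_le u x y
  have h4 : ‖∑ i ∈ u, star (x i) * y i‖ ^ 2 < ε ^ 2 := by
    refine h3.trans_lt ?_
    rw [sq]
    exact mul_lt_mul'' h1 h2 (norm_nonneg _) (norm_nonneg _)
  exact lt_of_pow_lt_pow_left₀ 2 hε.le h4

end CauchySchwarz

variable (A : Type*) [NonUnitalCStarAlgebra A]

/-- The standard Hilbert `A`-module `ℓ₂(A)`: the sequences `x` in `A` for which `∑ xᵢ* xᵢ`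
converges in norm. -/
def EllTwo : Submodule ℂ (ℕ → A) where
  carrier := {x | Summable fun i => star (x i) * x i}
  zero_mem' := by simpa using (summable_zero : Summable fun _ : ℕ => (0 : A))
  add_mem' {x y} hx hy := by
    have h := ((hx.add hy).add (summable_star_mul hx hy)).add (summable_star_mul hy hx)
    refine h.congr fun i => ?_
    simp only [Pi.add_apply, star_add, add_mul, mul_add]
    abel
  smul_mem' c x hx := by
    have h := Summable.const_smul (star c * c) hx
    refine h.congr fun i => ?_
    simp [smul_mul_smul_comm, star_smul]

variable {A}

/-- The `A`-valued inner product `⟨x, y⟩ = ∑ xᵢ* yᵢ` on `ℓ₂(A)`. -/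
def ellInner (x y : EllTwo A) : A := ∑' i, star (x.1 i) * y.1 i

theorem hasSum_ellInner (x y : EllTwo A) :
    HasSum (fun i => star (x.1 i) * y.1 i) (ellInner x y) :=
  (summable_star_mul x.2 y.2).hasSum

/-- The Hilbert module norm `‖x‖ = ‖⟨x, x⟩‖ ^ (1/2)` of `ℓ₂(A)`. -/
instance : Norm (EllTwo A) := ⟨fun x => √‖ellInner x x‖⟩

theorem ellNorm_sq (x : EllTwo A) : ‖x‖ ^ 2 = ‖ellInner x x‖ :=
  Real.sq_sqrt (norm_nonneg _)

theorem ellNorm_nonneg (x : EllTwo A) : 0 ≤ ‖x‖ := Real.sqrt_nonneg _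

theorem norm_ellInner_le (x y : EllTwo A) : ‖ellInner x y‖ ≤ ‖x‖ * ‖y‖ := by
  have h : ‖ellInner x y‖ ^ 2 ≤ ‖ellInner x x‖ * ‖ellInner y y‖ :=
    le_of_tendsto_of_tendsto ((Tendsto.norm (hasSum_ellInner x y)).pow 2)
      ((Tendsto.norm (hasSum_ellInner x x)).mul (Tendsto.norm (hasSum_ellInner y y)))
      (Eventually.of_forall fun s => norm_sum_star_mul_sq_le s x.1 y.1)
  rw [← ellNorm_sq, ← ellNorm_sq, ← mul_pow] at h
  exact le_of_sq_le_sq h (mul_nonneg (ellNorm_nonneg _) (ellNorm_nonneg _))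

theorem star_ellInner (x y : EllTwo A) : star (ellInner x y) = ellInner y x := by
  refine (hasSum_ellInner x y).star.unique ?_
  simpa using hasSum_ellInner y x

theorem ellInner_add_left (x y z : EllTwo A) :
    ellInner (x + y) z = ellInner x z + ellInner y z := by
  refine (hasSum_ellInner _ _).unique ?_
  simpa [add_mul] using (hasSum_ellInner x z).add (hasSum_ellInner y z)

theorem ellInner_add_right (x y z : EllTwo A) :
    ellInner x (y + z) = ellInner x y + ellInner x z := by
  refine (hasSum_ellInner _ _).unique ?_
  simpa [mul_add] using (hasSum_ellInner x y).add (hasSum_ellInner x z)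

theorem ellInner_smul_left (c : ℂ) (x y : EllTwo A) :
    ellInner (c • x) y = star c • ellInner x y := by
  refine (hasSum_ellInner _ _).unique ?_
  simpa [smul_mul_assoc] using (hasSum_ellInner x y).const_smul (star c)

theorem ellInner_smul_right (c : ℂ) (x y : EllTwo A) :
    ellInner x (c • y) = c • ellInner x y := by
  refine (hasSum_ellInner _ _).unique ?_
  simpa [mul_smul_comm] using (hasSum_ellInner x y).const_smul c

theorem ellNorm_add_sq_le (x y : EllTwo A) : ‖x + y‖ ^ 2 ≤ 2 * (‖x‖ ^ 2 + ‖y‖ ^ 2) := by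
  simp only [ellNorm_sq]
  exact le_of_tendsto_of_tendsto (Tendsto.norm (hasSum_ellInner (x + y) (x + y)))
    (((Tendsto.norm (hasSum_ellInner x x)).add
      (Tendsto.norm (hasSum_ellInner y y))).const_mul 2)
    (Eventually.of_forall fun s => norm_sum_star_add_le s x.1 y.1)

/-- The element of `ℓ₂(A)` with entry `a` in place `i` and `0` elsewhere. -/
def ellSingle (i : ℕ) (a : A) : EllTwo A :=
  ⟨Pi.single i a, summable_of_ne_finset_zero (s := {i}) fun j hj => by
    rw [Pi.single_eq_of_ne (by simpa using hj)]; simp⟩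

theorem ellInner_single_left (i : ℕ) (a : A) (x : EllTwo A) :
    ellInner (ellSingle i a) x = star a * x.1 i := by
  refine (hasSum_ellInner _ _).unique ?_
  convert hasSum_single i fun j hj => ?_ using 1
  · simp [ellSingle]
  · simp [ellSingle, Pi.single_eq_of_ne hj]

/-! ### The multiplier module `M(ℓ₂(A))` -/

variable (A) in
/-- The multiplier module `M(ℓ₂(A))`: all adjointable maps `r : A → ℓ₂(A)`, that is, bounded
`A`-linear maps for which there is `s : ℓ₂(A) → A` with `⟨r a, x⟩ = ⟨a, s x⟩ = a* (s x)`. -/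
def MulEllTwo : Submodule ℂ (A →ₗ[ℂ] EllTwo A) where
  carrier := {r | (∀ a b i, (r (a * b)).1 i = (r a).1 i * b) ∧
    (∃ C : ℝ, ∀ a, ‖r a‖ ≤ C * ‖a‖) ∧
    ∃ s : EllTwo A → A, ∀ a x, ellInner (r a) x = star a * s x}
  zero_mem' := by
    refine ⟨by simp, ⟨0, fun a => ?_⟩, ⟨0, fun a x => ?_⟩⟩
    · have h : ellInner (0 : EllTwo A) 0 = 0 := by simp [ellInner]
      have h' : ‖(0 : EllTwo A)‖ = 0 := by simp [norm, h]
      simp [h']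
    · simp [ellInner]
  add_mem' {r t} hr ht := by
    obtain ⟨h1, ⟨C, hC⟩, s, hs⟩ := hr
    obtain ⟨k1, ⟨D, hD⟩, u, hu⟩ := ht
    refine ⟨fun a b i => ?_, ⟨2 * (|C| + |D|), fun a => ?_⟩, ⟨s + u, fun a x => ?_⟩⟩
    · simp [h1, k1, add_mul]
    · have p : ‖r a‖ ≤ |C| * ‖a‖ := (hC a).trans (by gcongr; exact le_abs_self _)
      have q : ‖t a‖ ≤ |D| * ‖a‖ := (hD a).trans (by gcongr; exact le_abs_self _)
      have e := ellNorm_add_sq_le (r a) (t a)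
      have n1 := ellNorm_nonneg (r a)
      have n2 := ellNorm_nonneg (t a)
      have hle : ‖r a + t a‖ ≤ 2 * (‖r a‖ + ‖t a‖) :=
        le_of_sq_le_sq (e.trans (by nlinarith [mul_nonneg n1 n2])) (by positivity)
      rw [LinearMap.add_apply]
      linarith
    · rw [LinearMap.add_apply, ellInner_add_left, hs, hu, Pi.add_apply, mul_add]
  smul_mem' c r hr := by
    obtain ⟨h1, ⟨C, hC⟩, s, hs⟩ := hr
    refine ⟨fun a b i => ?_, ⟨‖c‖ * C, fun a => ?_⟩, ⟨fun x => star c • s x, fun a x => ?_⟩⟩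
    · simp [h1, smul_mul_assoc]
    · have : ‖c • r a‖ = ‖c‖ * ‖r a‖ := by
        have h : ‖c • r a‖ ^ 2 = (‖c‖ * ‖r a‖) ^ 2 := by
          rw [mul_pow, ellNorm_sq, ellNorm_sq, ellInner_smul_left, ellInner_smul_right, norm_smul,
            norm_smul, norm_star]
          ring
        exact (pow_left_inj₀ (ellNorm_nonneg _)
          (mul_nonneg (norm_nonneg _) (ellNorm_nonneg _)) two_ne_zero).1 h
      rw [LinearMap.smul_apply, this, mul_assoc]
      exact mul_le_mul_of_nonneg_left (hC a) (norm_nonneg c)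
    · rw [LinearMap.smul_apply, ellInner_smul_left, hs, mul_smul_comm]

theorem eq_of_star_mul_eq {s t : A} (h : ∀ a : A, star a * s = star a * t) : s = t := by
  have h' := h (s - t)
  rw [← sub_eq_zero, ← mul_sub, CStarRing.star_mul_self_eq_zero_iff] at h'
  exact sub_eq_zero.1 h'

/-- The adjoint `r* : ℓ₂(A) → A` of `r ∈ M(ℓ₂(A))`. -/
def adj (r : MulEllTwo A) : EllTwo A → A := r.2.2.2.choose

theorem ellInner_apply (r : MulEllTwo A) (a : A) (x : EllTwo A) :
    ellInner (r.1 a) x = star a * adj r x :=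
  r.2.2.2.choose_spec a x

theorem adj_eq {r : MulEllTwo A} {x : EllTwo A} {s : A}
    (h : ∀ a, ellInner (r.1 a) x = star a * s) : adj r x = s :=
  eq_of_star_mul_eq fun a => by rw [← ellInner_apply, h]

/-- The map `r₁* r₂ : A → A`, as a bounded operator. -/
def adjComp (r₁ r₂ : MulEllTwo A) : A →L[ℂ] A :=
  LinearMap.mkContinuousOfExistsBound
    { toFun := fun a => adj r₁ (r₂.1 a)
      map_add' := fun a b => adj_eq fun c => by
        rw [map_add, ellInner_add_right, ellInner_apply, ellInner_apply, mul_add]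
      map_smul' := fun c a => adj_eq fun b => by
        rw [map_smul, ellInner_smul_right, ellInner_apply, mul_smul_comm, RingHom.id_apply] }
    (by
      obtain ⟨C, hC⟩ := r₁.2.2.1
      obtain ⟨D, hD⟩ := r₂.2.2.1
      refine ⟨|C| * |D|, fun a => ?_⟩
      change ‖adj r₁ (r₂.1 a)‖ ≤ _
      set t := adj r₁ (r₂.1 a) with ht
      have h1 : ‖t‖ * ‖t‖ ≤ ‖t‖ * (|C| * |D| * ‖a‖) := by
        rw [← CStarRing.norm_star_mul_self, ht, ← ellInner_apply, ← ht]
        calc ‖ellInner (r₁.1 t) (r₂.1 a)‖ ≤ ‖r₁.1 t‖ * ‖r₂.1 a‖ := norm_ellInner_le _ _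
          _ ≤ (|C| * ‖t‖) * (|D| * ‖a‖) := by
            refine mul_le_mul ((hC t).trans ?_) ((hD a).trans ?_) (ellNorm_nonneg _) (by positivity)
            · gcongr; exact le_abs_self _
            · gcongr; exact le_abs_self _
          _ = ‖t‖ * (|C| * |D| * ‖a‖) := by ring
      rcases (norm_nonneg t).eq_or_lt with h | h
      · rw [← h]; positivity
      · exact le_of_mul_le_mul_left h1 h)

theorem adjComp_apply (r₁ r₂ : MulEllTwo A) (a : A) : adjComp r₁ r₂ a = adj r₁ (r₂.1 a) := rfl

/-- The `M(A)`-valued inner product `⟨r₁, r₂⟩ = r₁* r₂` on `M(ℓ₂(A))`. As a double centralizer, its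
left multiplication is `a ↦ r₁* (r₂ a)` and its right multiplication is `a ↦ (r₂* (r₁ a*))*`. -/
def mulInner (r₁ r₂ : MulEllTwo A) : 𝓜(ℂ, A) where
  fst := adjComp r₁ r₂
  snd := ((starₗᵢ ℂ : A ≃ₗᵢ⋆[ℂ] A) : A →L⋆[ℂ] A).comp
    ((adjComp r₂ r₁).comp ((starₗᵢ ℂ : A ≃ₗᵢ⋆[ℂ] A) : A →L⋆[ℂ] A))
  central x y := by
    change star (adj r₂ (r₁.1 (star x))) * y = x * adj r₁ (r₂.1 y)
    have h1 : star y * adj r₂ (r₁.1 (star x)) = ellInner (r₂.1 y) (r₁.1 (star x)) :=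
      (ellInner_apply _ _ _).symm
    have h2 : x * adj r₁ (r₂.1 y) = ellInner (r₁.1 (star x)) (r₂.1 y) := by
      rw [ellInner_apply, star_star]
    rw [h2, ← star_ellInner, ← h1, star_mul, star_star]

/-- The norm `‖r‖ = ‖⟨r, r⟩‖ ^ (1/2)` of the Hilbert `M(A)`-module `M(ℓ₂(A))`. -/
instance : Norm (MulEllTwo A) := ⟨fun r => √‖mulInner r r‖⟩

/-- The right action of `M(A)` on `M(ℓ₂(A))`: `(r m)(a) = r (m a)`. -/
instance : SMul 𝓜(ℂ, A)ᵐᵒᵖ (MulEllTwo A) where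
  smul m r := ⟨r.1.comp m.unop.fst.toLinearMap, by
    obtain ⟨h1, ⟨C, hC⟩, s, hs⟩ := r.2
    have hm : ∀ a b, m.unop.fst (a * b) = m.unop.fst a * b := fun a b =>
      eq_of_star_mul_eq fun c => by
        rw [← m.unop.central, ← mul_assoc, m.unop.central, mul_assoc]
    refine ⟨fun a b i => ?_, ⟨|C| * ‖m.unop.fst‖, fun a => ?_⟩,
      ⟨fun x => (star m.unop).fst (s x), fun a x => ?_⟩⟩
    · change (r.1 (m.unop.fst (a * b))).1 i = (r.1 (m.unop.fst a)).1 i * b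
      rw [hm, h1]
    · change ‖r.1 (m.unop.fst a)‖ ≤ _
      refine (hC _).trans ?_
      rw [mul_assoc]
      exact mul_le_mul (le_abs_self _) (m.unop.fst.le_opNorm a) (norm_nonneg _) (abs_nonneg _)
    · change ellInner (r.1 (m.unop.fst a)) x = _
      rw [hs, ← (star m.unop).central, DoubleCentralizer.star_snd, star_star]⟩

theorem op_smul_apply (m : 𝓜(ℂ, A)) (r : MulEllTwo A) (a : A) :
    (MulOpposite.op m • r).1 a = r.1 (m.fst a) := rfl

instance : Module 𝓜(ℂ, A)ᵐᵒᵖ (MulEllTwo A) where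
  one_smul r := rfl
  mul_smul m n r := rfl
  smul_zero m := rfl
  smul_add m r t := rfl
  add_smul m n r := Subtype.ext (LinearMap.ext fun a => map_add r.1 _ _)
  zero_smul r := Subtype.ext (LinearMap.ext fun a => map_zero r.1)

/-- The inclusion `a ↦ (0, …, 0, a, 0, …)` of `A` into `ℓ₂(A)` at place `i`, an element of
`M(ℓ₂(A))`. -/
def basisMul (i : ℕ) : MulEllTwo A :=
  ⟨{ toFun := ellSingle i
     map_add' := fun a b => Subtype.ext (Pi.single_add (f := fun _ => A) i a b)
     map_smul' := fun c a => Subtype.ext (Pi.single_smul (f := fun _ => A) i c a) }, by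
    refine ⟨fun a b j => ?_, ⟨1, fun a => ?_⟩, ⟨fun x => x.1 i, fun a x => ?_⟩⟩
    · change (Pi.single i (a * b) : ℕ → A) j = (Pi.single i a : ℕ → A) j * b
      by_cases h : j = i
      · subst h; simp
      · simp [Pi.single_eq_of_ne h]
    · change √‖ellInner (ellSingle i a) (ellSingle i a)‖ ≤ _
      rw [ellInner_single_left]
      have : (ellSingle i a).1 i = a := by simp [ellSingle]
      rw [this, CStarRing.norm_star_mul_self, Real.sqrt_mul_self (norm_nonneg _), one_mul]
    · exact ellInner_single_left i a x⟩

/-- The coordinates `βᵢ ∈ M(A)` of `β ∈ M(ℓ₂(A))`: left multiplication by `βᵢ` is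
`a ↦ (β a)ᵢ`. -/
def coord (β : MulEllTwo A) (i : ℕ) : 𝓜(ℂ, A) := mulInner (basisMul i) β

theorem coord_fst (β : MulEllTwo A) (i : ℕ) (a : A) : (coord β i).fst a = (β.1 a).1 i :=
  adj_eq (r := basisMul i) fun b => ellInner_single_left i b (β.1 a)

/-! ### The dual module `(M(ℓ₂(A)))'` -/

variable (A) in
/-- The dual module `(M(ℓ₂(A)))'`: the bounded `M(A)`-linear maps `M(ℓ₂(A)) → M(A)`. -/
def Dual : AddSubgroup (MulEllTwo A →ₗ[𝓜(ℂ, A)ᵐᵒᵖ] 𝓜(ℂ, A)) where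
  carrier := {F | ∃ C : ℝ, ∀ β, ‖F β‖ ≤ C * ‖β‖}
  zero_mem' := ⟨0, by simp⟩
  add_mem' := by
    rintro F G ⟨C, hC⟩ ⟨D, hD⟩
    exact ⟨C + D, fun β => (norm_add_le _ _).trans (by rw [add_mul]; exact add_le_add (hC β) (hD β))⟩
  neg_mem' := by
    rintro F ⟨C, hC⟩
    exact ⟨C, fun β => by simpa using hC β⟩

/-- The right action of `M(A)` on the dual module: `(F m)(β) = m* F(β)`. -/
instance : SMul 𝓜(ℂ, A)ᵐᵒᵖ (Dual A) where
  smul m F := ⟨{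
    toFun := fun β => star m.unop * F.1 β
    map_add' := fun β γ => by rw [map_add, mul_add]
    map_smul' := fun n β => by
      rw [map_smul, RingHom.id_apply, MulOpposite.smul_eq_mul_unop, MulOpposite.smul_eq_mul_unop,
        mul_assoc] }, by
    obtain ⟨C, hC⟩ := F.2
    refine ⟨‖m.unop‖ * C, fun β => ?_⟩
    refine (norm_mul_le _ _).trans ?_
    rw [norm_star, mul_assoc]
    exact mul_le_mul_of_nonneg_left (hC β) (norm_nonneg _)⟩

theorem dual_smul_apply (m : 𝓜(ℂ, A)) (F : Dual A) (β : MulEllTwo A) :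
    (MulOpposite.op m • F).1 β = star m * F.1 β := rfl

instance : Module 𝓜(ℂ, A)ᵐᵒᵖ (Dual A) where
  one_smul F := Subtype.ext (LinearMap.ext fun β => by
    change star (1 : 𝓜(ℂ, A)) * F.1 β = F.1 β
    rw [star_one, one_mul])
  mul_smul m n F := Subtype.ext (LinearMap.ext fun β => by
    change star (n.unop * m.unop) * F.1 β = star m.unop * (star n.unop * F.1 β)
    rw [star_mul, mul_assoc])
  smul_zero m := Subtype.ext (LinearMap.ext fun β => mul_zero (star m.unop))
  smul_add m F G := Subtype.ext (LinearMap.ext fun β => mul_add (star m.unop) _ _)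
  add_smul m n F := Subtype.ext (LinearMap.ext fun β => by
    change star (m.unop + n.unop) * F.1 β = star m.unop * F.1 β + star n.unop * F.1 β
    rw [star_add, add_mul])
  zero_smul F := Subtype.ext (LinearMap.ext fun β => by
    change star (0 : 𝓜(ℂ, A)) * F.1 β = 0
    rw [star_zero, zero_mul])

/-! ### Left multipliers and left strict convergence -/

variable (A) in
/-- The left multipliers `LM(A)`: bounded operators `u` on `A` with `u (a b) = (u a) b`. -/
def LeftMul : Submodule ℂ (A →L[ℂ] A) where
  carrier := {u | ∀ a b, u (a * b) = u a * b}
  zero_mem' := by simp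
  add_mem' {u v} hu hv := fun a b => by
    simp only [add_apply, hu a b, hv a b, add_mul]
  smul_mem' c u hu := fun a b => by
    simp only [smul_apply, hu a b, smul_mul_assoc]

/-- The inclusion `M(A) ⊆ LM(A)`. -/
def toLeftMul (m : 𝓜(ℂ, A)) : LeftMul A :=
  ⟨m.fst, fun a b => eq_of_star_mul_eq fun c => by
    rw [← m.central, ← mul_assoc, m.central, mul_assoc]⟩

/-- Left strict convergence of a sequence in `LM(A)`: `uₙ a → u a` in norm for all `a ∈ A`. -/
def LeftStrictTendsto (u : ℕ → LeftMul A) (v : LeftMul A) : Prop :=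
  ∀ a : A, Tendsto (fun n => (u n).1 a) atTop (𝓝 (v.1 a))

/-- The `n`-th partial sum of `∑ αᵢ* βᵢ`, as an element of `LM(A)`. -/
def partialSum (α : ℕ → 𝓜(ℂ, A)) (β : MulEllTwo A) (n : ℕ) : LeftMul A :=
  toLeftMul (∑ i ∈ Finset.range n, star (α i) * coord β i)

/-- The partial sums of `∑ αᵢ* αᵢ` are bounded in norm. -/
def BoundedPartialSums (α : ℕ → 𝓜(ℂ, A)) : Prop :=
  ∃ C : ℝ, ∀ n : ℕ, ‖∑ i ∈ Finset.range n, star (α i) * α i‖ ≤ C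

/-- The three conditions on a sequence in `M(A)`. -/
structure IsDualSeq (α : ℕ → 𝓜(ℂ, A)) : Prop where
  bounded : BoundedPartialSums α
  converges : ∀ β : MulEllTwo A, ∃ u : LeftMul A, LeftStrictTendsto (partialSum α β) u
  limit_mem : ∀ (β : MulEllTwo A) (u : LeftMul A), LeftStrictTendsto (partialSum α β) u →
    ∃ m : 𝓜(ℂ, A), u = toLeftMul m

theorem LeftStrictTendsto.unique {u : ℕ → LeftMul A} {v w : LeftMul A}
    (hv : LeftStrictTendsto u v) (hw : LeftStrictTendsto u w) : v = w :=
  Subtype.ext (ContinuousLinearMap.ext fun a => tendsto_nhds_unique (hv a) (hw a))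

theorem toLeftMul_apply (m : 𝓜(ℂ, A)) (a : A) : (toLeftMul m).1 a = m.fst a := rfl

theorem isDualSeq_of_limits {α : ℕ → 𝓜(ℂ, A)} (h : BoundedPartialSums α)
    (h' : ∀ β : MulEllTwo A, ∃ m, LeftStrictTendsto (partialSum α β) (toLeftMul m)) :
    IsDualSeq α where
  bounded := h
  converges β := (h' β).imp' toLeftMul fun _ hm => hm
  limit_mem β u hu := by
    obtain ⟨m, hm⟩ := h' β
    exact ⟨m, hu.unique hm⟩

theorem IsDualSeq.exists_limit {α : ℕ → 𝓜(ℂ, A)} (h : IsDualSeq α) (β : MulEllTwo A) :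
    ∃ m, LeftStrictTendsto (partialSum α β) (toLeftMul m) := by
  obtain ⟨u, hu⟩ := h.converges β
  obtain ⟨m, rfl⟩ := h.limit_mem β u hu
  exact ⟨m, hu⟩

variable (A) in
/-- The right `M(A)`-module of all sequences in `M(A)` that satisfy the three conditions, with the
entrywise operations `(α + α')ᵢ = αᵢ + α'ᵢ` and `(α m)ᵢ = αᵢ m`. -/
def DualSeq : Submodule 𝓜(ℂ, A)ᵐᵒᵖ (ℕ → 𝓜(ℂ, A)) where
  carrier := {α | IsDualSeq α}
  zero_mem' := by
    refine isDualSeq_of_limits ⟨0, by simp⟩ fun β => ⟨0, fun a => ?_⟩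
    simp [partialSum]
  add_mem' {α α'} hα hα' := by
    obtain ⟨C, hC⟩ := hα.bounded
    obtain ⟨D, hD⟩ := hα'.bounded
    refine isDualSeq_of_limits ⟨2 * (C + D), fun n => ?_⟩ fun β => ?_
    · refine (norm_sum_star_add_le _ _ _).trans ?_
      linarith [hC n, hD n]
    · obtain ⟨m, hm⟩ := hα.exists_limit β
      obtain ⟨m', hm'⟩ := hα'.exists_limit β
      refine ⟨m + m', fun a => ?_⟩
      have e : ∀ n, (partialSum (α + α') β n).1 a =
          (partialSum α β n).1 a + (partialSum α' β n).1 a := fun n => by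
        simp only [partialSum, toLeftMul_apply, Pi.add_apply, star_add, add_mul,
          Finset.sum_add_distrib, DoubleCentralizer.add_fst, add_apply]
      simp only [e]
      exact (hm a).add (hm' a)
  smul_mem' m α hα := by
    obtain ⟨C, hC⟩ := hα.bounded
    refine isDualSeq_of_limits ⟨‖m.unop‖ * C * ‖m.unop‖, fun n => ?_⟩ fun β => ?_
    · have e : ∑ i ∈ Finset.range n, star ((m • α) i) * (m • α) i =
          star m.unop * (∑ i ∈ Finset.range n, star (α i) * α i) * m.unop := by
        rw [Finset.mul_sum, Finset.sum_mul]
        refine Finset.sum_congr rfl fun i _ => ?_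
        rw [Pi.smul_apply, MulOpposite.smul_eq_mul_unop, star_mul]
        simp only [mul_assoc]
      rw [e]
      refine (norm_mul_le _ _).trans (mul_le_mul_of_nonneg_right ?_ (norm_nonneg _))
      refine (norm_mul_le _ _).trans ?_
      rw [norm_star]
      exact mul_le_mul_of_nonneg_left (hC n) (norm_nonneg _)
    · obtain ⟨l, hl⟩ := hα.exists_limit β
      refine ⟨star m.unop * l, fun a => ?_⟩
      have e : ∀ n, (partialSum (m • α) β n).1 a =
          (star m.unop).fst ((partialSum α β n).1 a) := fun n => by
        have : ∑ i ∈ Finset.range n, star ((m • α) i) * coord β i =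
            star m.unop * ∑ i ∈ Finset.range n, star (α i) * coord β i := by
          rw [Finset.mul_sum]
          refine Finset.sum_congr rfl fun i _ => ?_
          rw [Pi.smul_apply, MulOpposite.smul_eq_mul_unop, star_mul, mul_assoc]
        simp only [partialSum, toLeftMul_apply, this]
        rfl
      simp only [e]
      exact ((star m.unop).fst.continuous.tendsto _).comp (hl a)

/-! ### Strong convergence in a representation -/

variable {H : Type*} [NormedAddCommGroup H] [InnerProductSpace ℂ H] [CompleteSpace H]

/-- A representation of `A` on `H` is non-degenerate if the vectors `π(a) h` span a dense
subspace. -/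
def Nondegenerate (π : A →⋆ₙₐ[ℂ] (H →L[ℂ] H)) : Prop :=
  Dense (Submodule.span ℂ {ξ : H | ∃ (a : A) (h : H), ξ = π a h} : Set H)

/-- The map `f ↦ ∑ π(a) f(a)` on finitely supported functions `A → H`. -/
def repSum (π : A →⋆ₙₐ[ℂ] (H →L[ℂ] H)) : (A →₀ H) →ₗ[ℂ] H :=
  Finsupp.lsum ℂ fun a => (π a).toLinearMap

/-- The map `f ↦ ∑ π(m a) f(a)` on finitely supported functions `A → H`. -/
def repSumMul (π : A →⋆ₙₐ[ℂ] (H →L[ℂ] H)) (m : 𝓜(ℂ, A)) : (A →₀ H) →ₗ[ℂ] H :=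
  Finsupp.lsum ℂ fun a => (π (m.fst a)).toLinearMap

/-- The operator on `H` by which `m ∈ M(A)` acts: the bounded operator with
`π(a) h ↦ π(m a) h`. -/
def extendRep (π : A →⋆ₙₐ[ℂ] (H →L[ℂ] H)) (m : 𝓜(ℂ, A)) : H →L[ℂ] H :=
  LinearMap.extendOfNorm (repSumMul π m) (repSum π)

theorem denseRange_repSum {π : A →⋆ₙₐ[ℂ] (H →L[ℂ] H)} (hπ : Nondegenerate π) :
    DenseRange (repSum π) := by
  refine Dense.mono ?_ hπ
  have : Submodule.span ℂ {ξ : H | ∃ (a : A) (h : H), ξ = π a h} ≤ LinearMap.range (repSum π) := by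
    rw [Submodule.span_le]
    rintro _ ⟨a, h, rfl⟩
    exact ⟨Finsupp.single a h, by simp [repSum]⟩
  intro ξ hξ
  exact this hξ

theorem norm_repSumMul_le (π : A →⋆ₙₐ[ℂ] (H →L[ℂ] H)) (m : 𝓜(ℂ, A)) (f : A →₀ H) :
    ‖repSumMul π m f‖ ≤ ‖m‖ * ‖repSum π f‖ := by
  let _ : PartialOrder A := CStarAlgebra.spectralOrder A
  have : StarOrderedRing A := CStarAlgebra.spectralOrderedRing A
  have hu := CStarAlgebra.increasingApproximateUnit A
  have : (CStarAlgebra.approximateUnit A).NeBot := hu.neBot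
  have hc : Continuous π := map_continuous π
  have hmul : ∀ u a : A, m.fst (u * a) = m.fst u * a := (toLeftMul m).2
  have key : ∀ u : A, π (m.fst u) (repSum π f) = f.sum fun a h => π (m.fst (u * a)) h := by
    intro u
    simp only [repSum, Finsupp.lsum_apply, Finsupp.sum, map_sum, hmul, map_mul]
    rfl
  have hlim : Tendsto (fun u => π (m.fst u) (repSum π f)) (CStarAlgebra.approximateUnit A)
      (𝓝 (repSumMul π m f)) := by
    simp only [key]
    refine tendsto_finsetSum _ fun a _ => ?_
    have h1 : Tendsto (fun u => u * a) (CStarAlgebra.approximateUnit A) (𝓝 a) :=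
      hu.tendsto_mul_right a
    have h2 : Continuous fun b : A => π (m.fst b) (f a) :=
      (hc.comp m.fst.continuous).clm_apply continuous_const
    exact (h2.tendsto a).comp h1
  refine le_of_tendsto hlim.norm ?_
  filter_upwards [hu.eventually_norm] with u hu1
  refine ((π (m.fst u)).le_opNorm _).trans (mul_le_mul_of_nonneg_right ?_ (norm_nonneg _))
  refine (NonUnitalStarAlgHom.norm_apply_le π _).trans ?_
  refine (m.fst.le_opNorm u).trans ?_
  rw [DoubleCentralizer.norm_fst]
  exact mul_le_of_le_one_right (norm_nonneg _) hu1

theorem extendRep_apply {π : A →⋆ₙₐ[ℂ] (H →L[ℂ] H)} (hπ : Nondegenerate π) (m : 𝓜(ℂ, A))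
    (a : A) (h : H) : extendRep π m (π a h) = π (m.fst a) h := by
  have e := LinearMap.extendOfNorm_eq (denseRange_repSum hπ) ⟨‖m‖, norm_repSumMul_le π m⟩
    (Finsupp.single a h)
  simpa [repSum, repSumMul, extendRep] using e

/-- The series `∑ αᵢ* αᵢ` converges strongly in `B(H)`, where `M(A)` acts on `H` through the
representation `π` of `A`. -/
def StronglyConvergent (π : A →⋆ₙₐ[ℂ] (H →L[ℂ] H)) (α : ℕ → 𝓜(ℂ, A)) : Prop :=
  ∃ S : H →L[ℂ] H, ∀ h : H,
    Tendsto (fun n => ∑ i ∈ Finset.range n, extendRep π (star (α i) * α i) h) atTop (𝓝 (S h))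

end

end MultiplierDual

namespace MultiplierDual

section Representation

variable {A : Type*} [NonUnitalCStarAlgebra A]
  {H : Type*} [NormedAddCommGroup H] [InnerProductSpace ℂ H] [CompleteSpace H]
  {π : A →⋆ₙₐ[ℂ] (H →L[ℂ] H)}

theorem eq_extendRep (hπ : Nondegenerate π) {m : 𝓜(ℂ, A)} {T : H →L[ℂ] H}
    (h : ∀ a ξ, T (π a ξ) = π (m.fst a) ξ) : extendRep π m = T := by
  refine ContinuousLinearMap.ext_on hπ ?_
  rintro _ ⟨a, ξ, rfl⟩
  rw [extendRep_apply hπ, h]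

theorem extendRep_comp (hπ : Nondegenerate π) (m : 𝓜(ℂ, A)) (a : A) :
    extendRep π m * π a = π (m.fst a) :=
  ContinuousLinearMap.ext fun ξ => extendRep_apply hπ m a ξ

theorem norm_extendRep_le (hπ : Nondegenerate π) (m : 𝓜(ℂ, A)) : ‖extendRep π m‖ ≤ ‖m‖ :=
  LinearMap.opNorm_extendOfNorm_le (denseRange_repSum hπ) (norm_nonneg m) (norm_repSumMul_le π m)

theorem norm_le_norm_extendRep (hinj : Function.Injective π) (hπ : Nondegenerate π)
    (m : 𝓜(ℂ, A)) : ‖m‖ ≤ ‖extendRep π m‖ := by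
  rw [← DoubleCentralizer.norm_fst]
  refine ContinuousLinearMap.opNorm_le_bound _ (norm_nonneg _) fun a => ?_
  rw [← NonUnitalStarAlgHom.norm_map π hinj (m.fst a), ← extendRep_comp hπ]
  refine (norm_mul_le _ _).trans ?_
  rw [NonUnitalStarAlgHom.norm_map π hinj]

theorem extendRep_zero (hπ : Nondegenerate π) : extendRep π (0 : 𝓜(ℂ, A)) = 0 :=
  eq_extendRep hπ fun a ξ => by simp

theorem extendRep_add (hπ : Nondegenerate π) (m n : 𝓜(ℂ, A)) :
    extendRep π (m + n) = extendRep π m + extendRep π n :=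
  eq_extendRep hπ fun a ξ => by simp [extendRep_apply hπ]

theorem extendRep_sum (hπ : Nondegenerate π) {ι : Type*} (s : Finset ι) (m : ι → 𝓜(ℂ, A)) :
    extendRep π (∑ i ∈ s, m i) = ∑ i ∈ s, extendRep π (m i) :=
  map_sum (⟨⟨extendRep π, extendRep_zero hπ⟩, extendRep_add hπ⟩ : 𝓜(ℂ, A) →+ (H →L[ℂ] H)) m s

theorem extendRep_mul (hπ : Nondegenerate π) (m n : 𝓜(ℂ, A)) :
    extendRep π (m * n) = extendRep π m * extendRep π n :=
  eq_extendRep hπ fun a ξ => by simp [extendRep_apply hπ]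

theorem star_fst_mul (m : 𝓜(ℂ, A)) (a b : A) :
    star ((star m).fst a) * b = star a * m.fst b := by
  rw [DoubleCentralizer.star_fst, star_star, m.central]

theorem inner_extendRep_star (hπ : Nondegenerate π) (m : 𝓜(ℂ, A)) (ξ η : H) :
    inner ℂ (extendRep π (star m) ξ) η = inner ℂ ξ (extendRep π m η) := by
  suffices h : ContinuousLinearMap.adjoint (extendRep π m) = extendRep π (star m) by
    rw [← h, ContinuousLinearMap.adjoint_inner_left]
  refine (eq_extendRep hπ fun a ζ => ?_).symm
  refine ext_inner_right ℂ fun η => ?_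
  rw [ContinuousLinearMap.adjoint_inner_left]
  have hadj : ∀ (c : A) (u v : H), inner ℂ (π c u) v = inner ℂ u (π (star c) v) := fun c u v => by
    rw [map_star, ContinuousLinearMap.star_eq_adjoint, ContinuousLinearMap.adjoint_inner_right]
  have hdense : (fun η => inner ℂ (π a ζ) (extendRep π m η)) =
      fun η => inner ℂ (π ((star m).fst a) ζ) η := by
    have := ContinuousLinearMap.ext_on hπ
      (f := (innerSL ℂ (π a ζ)).comp (extendRep π m))
      (g := innerSL ℂ (π ((star m).fst a) ζ)) (by
        rintro _ ⟨b, θ, rfl⟩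
        simp only [ContinuousLinearMap.comp_apply, innerSL_apply_apply, extendRep_apply hπ, hadj]
        rw [← mul_apply_eq_comp, ← mul_apply_eq_comp, ← map_mul, ← map_mul, star_fst_mul])
    exact congrArg DFunLike.coe this
  exact congrFun hdense η

theorem inner_extendRep_star_mul (hπ : Nondegenerate π) (m : 𝓜(ℂ, A)) (ξ η : H) :
    inner ℂ (extendRep π (star m * m) ξ) η = inner ℂ (extendRep π m ξ) (extendRep π m η) := by
  rw [extendRep_mul hπ, mul_apply_eq_comp, inner_extendRep_star hπ]

theorem sum_norm_extendRep_sq_le (hπ : Nondegenerate π) {α : ℕ → 𝓜(ℂ, A)} {C : ℝ}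
    (hC : ∀ n : ℕ, ‖∑ i ∈ Finset.range n, star (α i) * α i‖ ≤ C) (s : Finset ℕ) (ξ : H) :
    ∑ i ∈ s, ‖extendRep π (α i) ξ‖ ^ 2 ≤ C * ‖ξ‖ ^ 2 := by
  obtain ⟨n, hn⟩ := s.exists_nat_subset_range
  refine (Finset.sum_le_sum_of_subset_of_nonneg hn fun i _ _ => sq_nonneg _).trans ?_
  have e : ((∑ i ∈ Finset.range n, ‖extendRep π (α i) ξ‖ ^ 2 : ℝ) : ℂ) =
      inner ℂ (extendRep π (∑ i ∈ Finset.range n, star (α i) * α i) ξ) ξ := by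
    rw [extendRep_sum hπ, sum_apply, sum_inner]
    push_cast
    refine Finset.sum_congr rfl fun i _ => ?_
    rw [inner_extendRep_star_mul hπ, inner_self_eq_norm_sq_to_K]
    rfl
  calc _ ≤ ‖((∑ i ∈ Finset.range n, ‖extendRep π (α i) ξ‖ ^ 2 : ℝ) : ℂ)‖ := by
        rw [Complex.norm_real]; exact Real.le_norm_self _
    _ ≤ ‖extendRep π (∑ i ∈ Finset.range n, star (α i) * α i) ξ‖ * ‖ξ‖ := by
        rw [e]; exact norm_inner_le_norm _ _
    _ ≤ (C * ‖ξ‖) * ‖ξ‖ := by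
        refine mul_le_mul_of_nonneg_right ?_ (norm_nonneg _)
        exact ContinuousLinearMap.le_of_opNorm_le _ ((norm_extendRep_le hπ _).trans (hC n)) ξ
    _ = C * ‖ξ‖ ^ 2 := by ring

theorem norm_sum_extendRep_star_mul_sq_le (hπ : Nondegenerate π) {α : ℕ → 𝓜(ℂ, A)} {C : ℝ}
    (hC : ∀ n : ℕ, ‖∑ i ∈ Finset.range n, star (α i) * α i‖ ≤ C) (s : Finset ℕ) (ξ : H) :
    ‖∑ i ∈ s, extendRep π (star (α i) * α i) ξ‖ ^ 2 ≤
      C * ∑ i ∈ s, ‖extendRep π (α i) ξ‖ ^ 2 := by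
  set v := ∑ i ∈ s, extendRep π (star (α i) * α i) ξ with hv
  have hC0 : 0 ≤ C := (norm_nonneg _).trans (hC 0)
  have h1 : ‖v‖ ^ 2 ≤ ∑ i ∈ s, ‖extendRep π (α i) ξ‖ * ‖extendRep π (α i) v‖ := by
    have e : ((‖v‖ ^ 2 : ℝ) : ℂ) =
        ∑ i ∈ s, inner ℂ (extendRep π (α i) ξ) (extendRep π (α i) v) := by
      have := inner_self_eq_norm_sq_to_K (𝕜 := ℂ) v
      push_cast
      refine this.symm.trans ?_
      conv_lhs => rw [hv, sum_inner]
      exact Finset.sum_congr rfl fun i _ => inner_extendRep_star_mul hπ _ _ _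
    calc ‖v‖ ^ 2 ≤ ‖((‖v‖ ^ 2 : ℝ) : ℂ)‖ := by
          rw [Complex.norm_real]; exact Real.le_norm_self _
      _ ≤ _ := by
          rw [e]
          exact (norm_sum_le _ _).trans (Finset.sum_le_sum fun i _ => norm_inner_le_norm _ _)
  have h2 := Finset.sum_mul_sq_le_sq_mul_sq s (fun i => ‖extendRep π (α i) ξ‖)
    fun i => ‖extendRep π (α i) v‖
  have h3 := sum_norm_extendRep_sq_le hπ hC s v
  set t := ∑ i ∈ s, ‖extendRep π (α i) ξ‖ ^ 2
  have ht : 0 ≤ t := Finset.sum_nonneg fun i _ => sq_nonneg _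
  have h4 : ‖v‖ ^ 2 * ‖v‖ ^ 2 ≤ ‖v‖ ^ 2 * (C * t) := by
    calc ‖v‖ ^ 2 * ‖v‖ ^ 2 = (‖v‖ ^ 2) ^ 2 := by ring
      _ ≤ _ := pow_le_pow_left₀ (sq_nonneg _) h1 2
      _ ≤ _ := h2
      _ ≤ t * (C * ‖v‖ ^ 2) := mul_le_mul_of_nonneg_left h3 ht
      _ = _ := by ring
  rcases (sq_nonneg ‖v‖).eq_or_lt with h | h
  · rw [← h]; positivity
  · exact le_of_mul_le_mul_left h4 h

theorem BoundedPartialSums.stronglyConvergent (hπ : Nondegenerate π) {α : ℕ → 𝓜(ℂ, A)}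
    (h : BoundedPartialSums α) : StronglyConvergent π α := by
  obtain ⟨C, hC⟩ := h
  have hC0 : 0 ≤ C := (norm_nonneg _).trans (hC 0)
  have hsum : ∀ ξ : H, Summable fun i => extendRep π (star (α i) * α i) ξ := fun ξ => by
    have hs : Summable fun i => ‖extendRep π (α i) ξ‖ ^ 2 :=
      summable_of_sum_le (fun i => sq_nonneg _) fun s => sum_norm_extendRep_sq_le hπ hC s ξ
    rw [summable_iff_vanishing_norm] at hs ⊢
    intro ε hε
    obtain ⟨s, hs⟩ := hs (ε ^ 2 / (C + 1)) (by positivity)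
    refine ⟨s, fun t ht => lt_of_pow_lt_pow_left₀ 2 hε.le ?_⟩
    have h1 := (Real.le_norm_self _).trans_lt (hs t ht)
    rw [lt_div_iff₀ (by positivity)] at h1
    have h2 : 0 ≤ ∑ i ∈ t, ‖extendRep π (α i) ξ‖ ^ 2 := Finset.sum_nonneg fun i _ => sq_nonneg _
    linarith [norm_sum_extendRep_star_mul_sq_le hπ hC t ξ]
  have hlim : Tendsto (fun n ξ => (∑ i ∈ Finset.range n, extendRep π (star (α i) * α i)) ξ) atTop
      (𝓝 fun ξ => ∑' i, extendRep π (star (α i) * α i) ξ) :=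
    tendsto_pi_nhds.2 fun ξ => by
      simpa only [sum_apply] using (hsum ξ).hasSum.tendsto_sum_nat
  exact ⟨continuousLinearMapOfTendsto _ hlim, fun ξ => (hsum ξ).hasSum.tendsto_sum_nat⟩

theorem StronglyConvergent.boundedPartialSums (hinj : Function.Injective π)
    (hπ : Nondegenerate π) {α : ℕ → 𝓜(ℂ, A)} (h : StronglyConvergent π α) :
    BoundedPartialSums α := by
  obtain ⟨S, hS⟩ := h
  obtain ⟨C, hC⟩ := banach_steinhaus
    (g := fun n => ∑ i ∈ Finset.range n, extendRep π (star (α i) * α i)) fun ξ => by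
      obtain ⟨C, hC⟩ := (hS ξ).norm.bddAbove_range
      exact ⟨C, fun n => by simpa only [sum_apply] using hC ⟨n, rfl⟩⟩
  refine ⟨C, fun n => (norm_le_norm_extendRep hinj hπ _).trans ?_⟩
  rw [extendRep_sum hπ]
  exact hC n

end Representation

section Multipliers

variable {A : Type*} [NonUnitalCStarAlgebra A]

theorem toLeftMul_injective : Function.Injective (toLeftMul : 𝓜(ℂ, A) → LeftMul A) := fun m n h => by
  have h' : (m - n).fst = 0 := by
    rw [DoubleCentralizer.sub_fst, sub_eq_zero]
    exact congrArg Subtype.val h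
  rw [← sub_eq_zero, ← norm_eq_zero, ← DoubleCentralizer.norm_fst, h', norm_zero]

theorem ext_fst {m n : 𝓜(ℂ, A)} (h : ∀ a, m.fst a = n.fst a) : m = n :=
  toLeftMul_injective (Subtype.ext (ContinuousLinearMap.ext h))

theorem sum_fst_apply {ι : Type*} (s : Finset ι) (m : ι → 𝓜(ℂ, A)) (a : A) :
    (∑ i ∈ s, m i).fst a = ∑ i ∈ s, (m i).fst a :=
  map_sum (⟨⟨fun m => m.fst a, rfl⟩, fun _ _ => rfl⟩ : 𝓜(ℂ, A) →+ A) m s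

variable (A) in
/-- The inclusion `A ⊆ M(A)`. -/
noncomputable abbrev inclusion : A →⋆ₙₐ[ℂ] 𝓜(ℂ, A) := DoubleCentralizer.coeHom

theorem mul_inclusion (m : 𝓜(ℂ, A)) (a : A) : m * inclusion A a = inclusion A (m.fst a) :=
  ext_fst fun b => (toLeftMul m).2 a b

theorem inclusion_fst (a b : A) : (inclusion A a).fst b = a * b := rfl

theorem norm_inclusion (a : A) : ‖inclusion A a‖ = ‖a‖ := by
  refine NonUnitalStarAlgHom.norm_map _ (fun b c h => ?_) a
  have h' : ∀ d : A, b * d = c * d := fun d => by rw [← inclusion_fst, h, inclusion_fst]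
  refine star_injective (eq_of_star_mul_eq fun d => ?_)
  rw [← star_mul, ← star_mul, h']

theorem norm_sum_range_star_mul_le {x : ℕ → A} {s : A}
    (h : HasSum (fun i => star (x i) * x i) s) (n : ℕ) :
    ‖∑ i ∈ Finset.range n, star (x i) * x i‖ ≤ ‖s‖ := by
  let _ : PartialOrder A := CStarAlgebra.spectralOrder A
  have : StarOrderedRing A := CStarAlgebra.spectralOrderedRing A
  refine ge_of_tendsto h.tendsto_sum_nat.norm ?_
  filter_upwards [eventually_ge_atTop n] with k hk
  exact CStarAlgebra.norm_le_norm_of_nonneg_of_le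
    (Finset.sum_nonneg fun i _ => star_mul_self_nonneg _)
    (Finset.sum_le_sum_of_subset_of_nonneg (Finset.range_mono hk)
      fun i _ _ => star_mul_self_nonneg _)

end Multipliers

section MultiplierModule

variable {A : Type*} [NonUnitalCStarAlgebra A]

theorem mulNorm_sq (β : MulEllTwo A) : ‖β‖ ^ 2 = ‖mulInner β β‖ :=
  Real.sq_sqrt (norm_nonneg _)

theorem mulNorm_nonneg (β : MulEllTwo A) : 0 ≤ ‖β‖ := Real.sqrt_nonneg _

theorem mulInner_eq {β γ : MulEllTwo A} {m : 𝓜(ℂ, A)}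
    (h : ∀ a b, ellInner (β.1 a) (γ.1 b) = star a * m.fst b) : mulInner β γ = m :=
  ext_fst fun b => adj_eq fun a => h a b

theorem ellNorm_apply_le (β : MulEllTwo A) (a : A) : ‖β.1 a‖ ≤ ‖β‖ * ‖a‖ := by
  refine le_of_sq_le_sq ?_ (mul_nonneg (mulNorm_nonneg β) (norm_nonneg a))
  rw [ellNorm_sq, ellInner_apply, mul_pow, mulNorm_sq, ← DoubleCentralizer.norm_fst]
  calc ‖star a * (mulInner β β).fst a‖ ≤ ‖star a‖ * (‖(mulInner β β).fst‖ * ‖a‖) :=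
        (norm_mul_le _ _).trans
          (mul_le_mul_of_nonneg_left (ContinuousLinearMap.le_opNorm _ a) (norm_nonneg _))
    _ = _ := by rw [norm_star]; ring

theorem mulNorm_inclusion_smul (β : MulEllTwo A) (a : A) :
    ‖MulOpposite.op (inclusion A a) • β‖ = ‖β.1 a‖ := by
  have h : mulInner (MulOpposite.op (inclusion A a) • β) (MulOpposite.op (inclusion A a) • β) =
      inclusion A (ellInner (β.1 a) (β.1 a)) := mulInner_eq fun b c => by
    refine (hasSum_ellInner _ _).unique ?_
    have := ((hasSum_ellInner (β.1 a) (β.1 a)).mul_left (star b)).mul_right c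
    simpa [op_smul_apply, β.2.1, inclusion_fst, mul_assoc] using this
  refine (pow_left_inj₀ (mulNorm_nonneg _) (ellNorm_nonneg _) two_ne_zero).1 ?_
  rw [mulNorm_sq, ellNorm_sq, h, norm_inclusion]

theorem basisMul_apply (i j : ℕ) (a : A) : ((basisMul i).1 a).1 j = if j = i then a else 0 :=
  Pi.single_apply i a j

/-- The element `(m₀, …, mₙ₋₁, 0, …)` of `M(ℓ₂(A))`. -/
noncomputable def finVec (m : ℕ → 𝓜(ℂ, A)) (n : ℕ) : MulEllTwo A :=
  ∑ i ∈ Finset.range n, MulOpposite.op (m i) • basisMul i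

theorem finVec_apply (m : ℕ → 𝓜(ℂ, A)) (n : ℕ) (a : A) (j : ℕ) :
    ((finVec m n).1 a).1 j = if j < n then (m j).fst a else 0 := by
  have h : ((finVec m n).1 a).1 j =
      ∑ i ∈ Finset.range n, ((basisMul i).1 ((m i).fst a)).1 j :=
    map_sum (⟨⟨fun β => (β.1 a).1 j, rfl⟩, fun _ _ => rfl⟩ : MulEllTwo A →+ A) _ _
  simp [h, basisMul_apply]

theorem mulNorm_finVec_sq (m : ℕ → 𝓜(ℂ, A)) (n : ℕ) :
    ‖finVec m n‖ ^ 2 = ‖∑ i ∈ Finset.range n, star (m i) * m i‖ := by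
  rw [mulNorm_sq]
  congr 1
  refine mulInner_eq fun a b => (hasSum_ellInner _ _).unique ?_
  rw [sum_fst_apply, Finset.mul_sum]
  have h : ∀ i ∈ Finset.range n, star a * (star (m i) * m i).fst b =
      star (((finVec m n).1 a).1 i) * ((finVec m n).1 b).1 i := fun i hi => by
    rw [finVec_apply, finVec_apply, if_pos (Finset.mem_range.1 hi),
      if_pos (Finset.mem_range.1 hi), DoubleCentralizer.mul_fst, mul_apply_eq_comp]
    have := star_fst_mul (star (m i)) a ((m i).fst b)
    rw [star_star] at this
    exact this.symm
  rw [Finset.sum_congr rfl h]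
  refine hasSum_sum_of_ne_finset_zero fun i hi => ?_
  rw [finVec_apply _ _ b, if_neg (by simpa using hi), mul_zero]

/-- The element `(0, …, 0, βₙ, βₙ₊₁, …)` of `M(ℓ₂(A))`. -/
noncomputable def tailVec (β : MulEllTwo A) (n : ℕ) : MulEllTwo A :=
  β + MulOpposite.op (-1 : 𝓜(ℂ, A)) • finVec (coord β) n

theorem tendsto_ellNorm_tailVec (β : MulEllTwo A) (a : A) :
    Tendsto (fun n => ‖(tailVec β n).1 a‖) atTop (𝓝 0) := by
  set x := β.1 a with hx
  have hcoord : ∀ n i, ((tailVec β n).1 a).1 i = if i < n then 0 else x.1 i :=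
    fun n i => by
      have : ((tailVec β n).1 a).1 i = x.1 i + ((finVec (coord β) n).1 (-a)).1 i := rfl
      rw [this, finVec_apply, coord_fst, map_neg]
      split_ifs <;> simp [hx]
  have hinner : ∀ n, ellInner ((tailVec β n).1 a) ((tailVec β n).1 a) =
      ellInner x x - ∑ i ∈ Finset.range n, star (x.1 i) * x.1 i := fun n => by
    refine (hasSum_ellInner _ _).unique ?_
    have h1 : HasSum (fun i => if i < n then star (x.1 i) * x.1 i else 0)
        (∑ i ∈ Finset.range n, star (x.1 i) * x.1 i) := by
      rw [Finset.sum_congr rfl fun i hi =>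
        (if_pos (Finset.mem_range.1 hi) : (if i < n then star (x.1 i) * x.1 i else 0) = _).symm]
      exact hasSum_sum_of_ne_finset_zero fun i hi => if_neg (by simpa using hi)
    refine ((hasSum_ellInner x x).sub h1).congr_fun fun i => ?_
    rw [hcoord]
    split_ifs <;> simp
  have hlim : Tendsto (fun n => √‖ellInner x x - ∑ i ∈ Finset.range n, star (x.1 i) * x.1 i‖) atTop
      (𝓝 (√‖ellInner x x - ellInner x x‖)) :=
    (Real.continuous_sqrt.tendsto _).comp
      ((hasSum_ellInner x x).tendsto_sum_nat.const_sub (ellInner x x)).norm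
  rw [sub_self, norm_zero, Real.sqrt_zero] at hlim
  refine hlim.congr fun n => ?_
  rw [← hinner n]
  rfl

end MultiplierModule

section DualModule

variable {A : Type*} [NonUnitalCStarAlgebra A]

theorem coord_basisMul (i j : ℕ) :
    coord (basisMul i : MulEllTwo A) j = if j = i then 1 else 0 := ext_fst fun a => by
  rw [coord_fst, basisMul_apply]
  split_ifs <;> rfl

theorem coord_add (β γ : MulEllTwo A) (i : ℕ) : coord (β + γ) i = coord β i + coord γ i :=
  ext_fst fun a => by
    rw [DoubleCentralizer.add_fst, add_apply, coord_fst, coord_fst, coord_fst]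
    rfl

theorem coord_op_smul (m : 𝓜(ℂ, A)) (β : MulEllTwo A) (i : ℕ) :
    coord (MulOpposite.op m • β) i = coord β i * m := ext_fst fun a => by
  rw [coord_fst, op_smul_apply, ← coord_fst]
  rfl

/-- The sequence `αᵢ = F(eᵢ)*` of a functional `F`. -/
noncomputable def dualCoord (F : Dual A) (i : ℕ) : 𝓜(ℂ, A) := star (F.1 (basisMul i))

theorem dual_finVec (F : Dual A) (m : ℕ → 𝓜(ℂ, A)) (n : ℕ) :
    F.1 (finVec m n) = ∑ i ∈ Finset.range n, star (dualCoord F i) * m i := by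
  simp only [finVec, map_sum, map_smul, dualCoord, star_star, MulOpposite.smul_eq_mul_unop,
    MulOpposite.unop_op]

theorem dual_boundedPartialSums (F : Dual A) : BoundedPartialSums (dualCoord F) := by
  obtain ⟨C, hC⟩ := F.2
  refine ⟨C ^ 2, fun n => ?_⟩
  have h := hC (finVec (dualCoord F) n)
  have h2 := mulNorm_finVec_sq (dualCoord F) n
  rw [dual_finVec] at h
  set t := ‖∑ i ∈ Finset.range n, star (dualCoord F i) * dualCoord F i‖
  have ht : 0 ≤ t := norm_nonneg _
  have h3 : t * t ≤ t * C ^ 2 := by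
    calc t * t = t ^ 2 := by ring
      _ ≤ _ := pow_le_pow_left₀ ht h 2
      _ = t * C ^ 2 := by rw [mul_pow, h2, mul_comm]
  rcases ht.eq_or_lt with h0 | h0
  · rw [← h0]; positivity
  · exact le_of_mul_le_mul_left h3 h0

theorem dual_leftStrictTendsto (F : Dual A) (β : MulEllTwo A) :
    LeftStrictTendsto (partialSum (dualCoord F) β) (toLeftMul (F.1 β)) := fun a => by
  obtain ⟨C, hC⟩ := F.2
  have hsplit : ∀ n, F.1 (tailVec β n) =
      F.1 β - ∑ i ∈ Finset.range n, star (dualCoord F i) * coord β i := fun n => by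
    rw [tailVec, map_add, map_smul, dual_finVec, MulOpposite.smul_eq_mul_unop,
      MulOpposite.unop_op, mul_neg_one, sub_eq_add_neg]
  have hle : ∀ n, ‖(partialSum (dualCoord F) β n).1 a - (toLeftMul (F.1 β)).1 a‖ ≤
      C * ‖(tailVec β n).1 a‖ := fun n => by
    rw [← mulNorm_inclusion_smul, norm_sub_rev]
    refine le_trans (le_of_eq ?_) (hC _)
    rw [map_smul, MulOpposite.smul_eq_mul_unop, MulOpposite.unop_op, mul_inclusion,
      norm_inclusion, hsplit]
    rfl
  rw [tendsto_iff_norm_sub_tendsto_zero]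
  refine squeeze_zero (fun _ => norm_nonneg _) hle ?_
  simpa using (tendsto_ellNorm_tailVec β a).const_mul C

theorem isDualSeq_dualCoord (F : Dual A) : IsDualSeq (dualCoord F) :=
  isDualSeq_of_limits (dual_boundedPartialSums F) fun β => ⟨F.1 β, dual_leftStrictTendsto F β⟩

theorem norm_partialSum_apply_sq_le {α : ℕ → 𝓜(ℂ, A)} {C : ℝ}
    (hC : ∀ n : ℕ, ‖∑ i ∈ Finset.range n, star (α i) * α i‖ ≤ C) (β : MulEllTwo A) (n : ℕ)
    (a : A) : ‖(partialSum α β n).1 a‖ ^ 2 ≤ C * (‖β‖ * ‖a‖) ^ 2 := by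
  have e1 : ∑ i ∈ Finset.range n, star (α i) * inclusion A ((β.1 a).1 i) =
      inclusion A ((partialSum α β n).1 a) := by
    change _ = inclusion A ((∑ i ∈ Finset.range n, star (α i) * coord β i).fst a)
    rw [← mul_inclusion, Finset.sum_mul]
    refine Finset.sum_congr rfl fun i _ => ?_
    rw [mul_assoc, mul_inclusion (coord β i), coord_fst]
  have e2 : ∑ i ∈ Finset.range n, star (inclusion A ((β.1 a).1 i)) * inclusion A ((β.1 a).1 i) =
      inclusion A (∑ i ∈ Finset.range n, star ((β.1 a).1 i) * (β.1 a).1 i) := by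
    simp only [map_sum, map_mul, map_star]
  have h := norm_sum_star_mul_sq_le (Finset.range n) α fun i => inclusion A ((β.1 a).1 i)
  rw [e1, e2, norm_inclusion, norm_inclusion] at h
  refine h.trans (mul_le_mul (hC n) ?_ (norm_nonneg _) ((norm_nonneg _).trans (hC 0)))
  refine (norm_sum_range_star_mul_le (hasSum_ellInner (β.1 a) (β.1 a)) n).trans ?_
  rw [← ellNorm_sq]
  exact pow_le_pow_left₀ (ellNorm_nonneg _) (ellNorm_apply_le β a) 2

theorem norm_limit_le {α : ℕ → 𝓜(ℂ, A)} {C : ℝ}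
    (hC : ∀ n : ℕ, ‖∑ i ∈ Finset.range n, star (α i) * α i‖ ≤ C) {β : MulEllTwo A} {m : 𝓜(ℂ, A)}
    (hm : LeftStrictTendsto (partialSum α β) (toLeftMul m)) : ‖m‖ ≤ √C * ‖β‖ := by
  have hC0 : 0 ≤ C := (norm_nonneg _).trans (hC 0)
  rw [← DoubleCentralizer.norm_fst]
  refine ContinuousLinearMap.opNorm_le_bound _
    (mul_nonneg (Real.sqrt_nonneg _) (mulNorm_nonneg _)) fun a => ?_
  refine le_of_tendsto (hm a).norm (Eventually.of_forall fun n => ?_)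
  refine le_of_sq_le_sq ((norm_partialSum_apply_sq_le hC β n a).trans_eq ?_)
    (mul_nonneg (mul_nonneg (Real.sqrt_nonneg _) (mulNorm_nonneg _)) (norm_nonneg _))
  rw [mul_assoc √C, mul_pow √C, Real.sq_sqrt hC0]

theorem eq_of_leftStrictTendsto {α : ℕ → 𝓜(ℂ, A)} {β : MulEllTwo A} {m n : 𝓜(ℂ, A)}
    (hm : LeftStrictTendsto (partialSum α β) (toLeftMul m))
    (hn : LeftStrictTendsto (partialSum α β) (toLeftMul n)) : m = n :=
  toLeftMul_injective (hm.unique hn)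

theorem partialSum_add_apply (α : ℕ → 𝓜(ℂ, A)) (β γ : MulEllTwo A) (n : ℕ) (a : A) :
    (partialSum α (β + γ) n).1 a = (partialSum α β n).1 a + (partialSum α γ n).1 a := by
  simp only [partialSum, toLeftMul_apply, coord_add, mul_add, Finset.sum_add_distrib,
    DoubleCentralizer.add_fst, add_apply]

theorem partialSum_op_smul_apply (α : ℕ → 𝓜(ℂ, A)) (m : 𝓜(ℂ, A)) (β : MulEllTwo A) (n : ℕ)
    (a : A) : (partialSum α (MulOpposite.op m • β) n).1 a = (partialSum α β n).1 (m.fst a) := by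
  simp only [partialSum, toLeftMul_apply, coord_op_smul, ← mul_assoc, ← Finset.sum_mul,
    DoubleCentralizer.mul_fst, mul_apply_eq_comp]

theorem exists_dual_of_isDualSeq {α : ℕ → 𝓜(ℂ, A)} (h : IsDualSeq α) :
    ∃ F : Dual A, ∀ β, LeftStrictTendsto (partialSum α β) (toLeftMul (F.1 β)) := by
  choose f hf using h.exists_limit
  obtain ⟨C, hC⟩ := h.bounded
  refine ⟨⟨{ toFun := f, map_add' := fun β γ => ?_, map_smul' := fun m β => ?_ },
    √C, fun β => norm_limit_le hC (hf β)⟩, hf⟩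
  · refine eq_of_leftStrictTendsto (hf _) fun a => ?_
    simp only [partialSum_add_apply]
    exact (hf β a).add (hf γ a)
  · refine eq_of_leftStrictTendsto (hf _) fun a => ?_
    have := hf β (m.unop.fst a)
    simp only [← partialSum_op_smul_apply, MulOpposite.op_unop] at this
    exact this

theorem partialSum_basisMul (α : ℕ → 𝓜(ℂ, A)) {i n : ℕ} (hi : i < n) :
    partialSum α (basisMul i) n = toLeftMul (star (α i)) := by
  simp [partialSum, coord_basisMul, hi]

theorem dualCoord_eq {α : ℕ → 𝓜(ℂ, A)} {F : Dual A}
    (h : ∀ β, LeftStrictTendsto (partialSum α β) (toLeftMul (F.1 β))) : dualCoord F = α := by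
  funext i
  have h' : LeftStrictTendsto (partialSum α (basisMul i)) (toLeftMul (star (α i))) := fun a => by
    refine tendsto_const_nhds.congr' ?_
    filter_upwards [eventually_gt_atTop i] with n hn
    rw [partialSum_basisMul α hn]
  rw [dualCoord, eq_of_leftStrictTendsto (h _) h', star_star]

/-- The map `F ↦ (F(eᵢ)*)` from the dual module to the module of sequences. -/
noncomputable def dualToSeq : Dual A →ₗ[𝓜(ℂ, A)ᵐᵒᵖ] DualSeq A where
  toFun F := ⟨dualCoord F, isDualSeq_dualCoord F⟩
  map_add' F G := Subtype.ext (funext fun i => star_add (F.1 (basisMul i)) (G.1 (basisMul i)))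
  map_smul' m F := Subtype.ext (funext fun i => by
    change star (star m.unop * F.1 (basisMul i)) = star (F.1 (basisMul i)) * m.unop
    rw [star_mul, star_star])

theorem dualToSeq_bijective : Function.Bijective (dualToSeq : Dual A → DualSeq A) := by
  refine ⟨fun F G h => Subtype.ext (LinearMap.ext fun β => ?_), fun α => ?_⟩
  · have h' : dualCoord F = dualCoord G := congrArg Subtype.val h
    refine eq_of_leftStrictTendsto (dual_leftStrictTendsto F β) ?_
    rw [h']
    exact dual_leftStrictTendsto G β
  · obtain ⟨F, hF⟩ := exists_dual_of_isDualSeq α.2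
    exact ⟨F, Subtype.ext (dualCoord_eq hF)⟩

end DualModule

end MultiplierDual

theorem mainTheorem2 {A : Type*} [NonUnitalCStarAlgebra A]
    {H : Type*} [NormedAddCommGroup H] [InnerProductSpace ℂ H] [CompleteSpace H]
    (π : A →⋆ₙₐ[ℂ] (H →L[ℂ] H))
    (hπ_inj : Function.Injective π) (hπ : MultiplierDual.Nondegenerate π) :
    (∀ α : ℕ → 𝓜(ℂ, A), MultiplierDual.BoundedPartialSums α ↔ MultiplierDual.StronglyConvergent π α) ∧
    ∃ Φ : MultiplierDual.Dual A ≃ₗ[𝓜(ℂ, A)ᵐᵒᵖ] MultiplierDual.DualSeq A,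
      ∀ (F : MultiplierDual.Dual A) (β : MultiplierDual.MulEllTwo A),
        MultiplierDual.LeftStrictTendsto (MultiplierDual.partialSum (Φ F).1 β)
          (MultiplierDual.toLeftMul (F.1 β)) :=
  ⟨fun _ => ⟨fun h => h.stronglyConvergent hπ, fun h => h.boundedPartialSums hπ_inj hπ⟩,
    LinearEquiv.ofBijective MultiplierDual.dualToSeq MultiplierDual.dualToSeq_bijective,
    fun F β => MultiplierDual.dual_leftStrictTendsto F β⟩
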